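/- Call a family $\mathcal{A}$ of subsets of $\mathbb{N}$ almost disjoint if it is infinite, all its members are infinite, and any two distinct members have finite intersection. Two families $\mathcal{B},\mathcal{C}$ of subsets of $\mathbb{N}$ are separated if there is $X\subseteq\mathbb{N}$ such that $B\setminus X$ is finite for every $B\in\mathcal{B}$ and $C\cap X$ is finite for every $C\in\mathcal{C}$. An almost disjoint family is inseparable (Luzin) if it has cardinality $\omega_1$ and no two uncountable subfamilies of it are separated. Corollary. (In ZFC) there is an almost disjoint family $\mathcal{A}$ of subsets of $\mathbb{N}$, of cardinality $\omega_1$, which is inseparable (Luzin), but such that for every countable $\mathcal{B}\subseteq\mathcal{A}$ the families $\mathcal{B}$ and $\mathcal{A}\setminus\mathcal{B}$ are separated. -/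

import Mathlib

namespace ADFamily

/-- An almost disjoint family: an infinite family of infinite subsets of `ℕ`, any two distinct
members of which have finite intersection. -/
def IsAlmostDisjoint (A : Set (Set ℕ)) : Prop :=
  A.Infinite ∧ (∀ a ∈ A, a.Infinite) ∧ ∀ a ∈ A, ∀ b ∈ A, a ≠ b → (a ∩ b).Finite

/-- Two families `B`, `C` of subsets of `ℕ` are separated if some `X ⊆ ℕ` almost contains every
member of `B` and is almost disjoint from every member of `C`. -/
def AreSeparated (B C : Set (Set ℕ)) : Prop :=
  ∃ X : Set ℕ, (∀ b ∈ B, (b \ X).Finite) ∧ (∀ c ∈ C, (c ∩ X).Finite)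

/-- An inseparable (Luzin) family: an almost disjoint family of cardinality `ω₁` no two
uncountable subfamilies of which are separated. -/
def IsInseparable (A : Set (Set ℕ)) : Prop :=
  IsAlmostDisjoint A ∧ Cardinal.mk A = Cardinal.aleph 1 ∧
    ∀ B C : Set (Set ℕ), B ⊆ A → C ⊆ A → ¬ B.Countable → ¬ C.Countable → ¬ AreSeparated B C

end ADFamily

namespace ADFamily

open Filter Set

/-! Build by recursion on `ω₁` pairs of disjoint infinite sets. The second members decrease modulo
finite sets, and each first member is almost contained in all earlier second members. The family
consists of the first members.

If `c` lies above a countable subfamily, the union of the pair at `c` is almost disjoint from every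
first member before `c`, while it contains the first member at `c` and almost contains all later
ones. Only the countably many members before `c` remain to be separated, which disjointification
does. The family is Luzin because, for each `c` and `k`, only finitely many earlier first members
meet that of `c` in at most `k` points.

The difficulty is to preserve this finiteness for both halves of the new pair at every countable
stage. The polynomial form of sparseness serves this: it survives diagonalization
(`exists_diagonal`) and, by Hall's theorem, splitting into disjoint pieces of about square-root size
(`exists_split`). -/

/-- A family `s` of sizes is sparse: for every exponent `c`, at most `m` of the sizes are bounded
by `m ^ c`, for all large `m`. -/
def SparseSizes {ι : Type*} (s : ι → ℕ∞) : Prop :=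
  ∀ c : ℕ, ∀ᶠ m : ℕ in atTop, {i | s i ≤ ((m ^ c : ℕ) : ℕ∞)}.encard ≤ m

/-! ### Closure properties of sparseness -/

namespace SparseSizes

variable {ι κ : Type*}

theorem mono {s t : ι → ℕ∞} (hs : SparseSizes s) (h : ∀ i, s i ≤ t i) : SparseSizes t := by
  intro c
  filter_upwards [hs c] with m hm
  exact (encard_le_encard fun i (hi : t i ≤ _) => (h i).trans hi).trans hm

theorem comp_injective {s : ι → ℕ∞} (hs : SparseSizes s) {f : κ → ι} (hf : f.Injective) :
    SparseSizes (s ∘ f) := by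
  intro c
  filter_upwards [hs c] with m hm
  refine le_trans ?_ hm
  rw [← hf.encard_image]
  refine encard_le_encard ?_
  rintro _ ⟨k, hk, rfl⟩
  exact hk

theorem finite_le {s : ι → ℕ∞} (hs : SparseSizes s) (k : ℕ) : {i | s i ≤ k}.Finite := by
  obtain ⟨m, hm, hk⟩ := ((hs 1).and (eventually_ge_atTop k)).exists
  have : {i | s i ≤ ((m ^ 1 : ℕ) : ℕ∞)}.Finite :=
    finite_of_encard_le_coe hm
  refine this.subset fun i (hi : s i ≤ k) => hi.trans ?_
  rw [pow_one]
  exact_mod_cast hk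

theorem min {s t : ι → ℕ∞} (hs : SparseSizes s) (ht : SparseSizes t) :
    SparseSizes fun i => min (s i) (t i) := by
  intro c
  have hhalf : Tendsto (fun m : ℕ => m / 2) atTop atTop :=
    Nat.tendsto_div_const_atTop (by norm_num)
  filter_upwards [hhalf.eventually (hs (2 * c)), hhalf.eventually (ht (2 * c)),
    eventually_ge_atTop 6] with m h1 h2 hm
  -- Doubling the exponent pays for halving the base.
  have hle : m ^ c ≤ (m / 2) ^ (2 * c) := by
    rw [pow_mul]
    refine Nat.pow_le_pow_left ?_ c
    have h3 : 3 ≤ m / 2 := by omega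
    have h4 : m ≤ 2 * (m / 2) + 1 := by omega
    nlinarith
  have hle' : ((m ^ c : ℕ) : ℕ∞) ≤ (((m / 2) ^ (2 * c) : ℕ) : ℕ∞) := by exact_mod_cast hle
  calc _ ≤ ({i | s i ≤ (((m / 2) ^ (2 * c) : ℕ) : ℕ∞)} ∪
        {i | t i ≤ (((m / 2) ^ (2 * c) : ℕ) : ℕ∞)}).encard := by
        refine encard_le_encard fun i hi => ?_
        rcases min_le_iff.1 (show Min.min (s i) (t i) ≤ _ from hi) with h | h
        · exact Or.inl (h.trans hle')
        · exact Or.inr (h.trans hle')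
    _ ≤ _ := encard_union_le _ _
    _ ≤ ((m / 2 : ℕ) : ℕ∞) + ((m / 2 : ℕ) : ℕ∞) := add_le_add h1 h2
    _ ≤ m := by
        have : m / 2 + m / 2 ≤ m := by omega
        exact_mod_cast this

/-- Sparseness is insensitive to bounded changes of the sizes, to infinite sizes and to one
exceptional index. -/
theorem of_le_add {s : ι → ℕ∞} {t : κ → ℕ∞} (ht : SparseSizes t) (f : κ → ι) (x : ι) (k : ℕ)
    (h : ∀ i, i = x ∨ s i = ⊤ ∨ ∃ j, f j = i ∧ t j ≤ s i + k) : SparseSizes s := by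
  intro c
  have hpred : Tendsto (fun m : ℕ => m - 1) atTop atTop := tendsto_sub_atTop_nat 1
  filter_upwards [hpred.eventually (ht (2 * c + 1)), eventually_ge_atTop (k + 6)] with m h1 hm
  have hle : m ^ c + k ≤ (m - 1) ^ (2 * c + 1) := by
    obtain ⟨n, rfl⟩ : ∃ n, m = n + 1 := ⟨m - 1, by omega⟩
    have h2 : (n + 1) ^ c ≤ n ^ (2 * c) := by
      rw [pow_mul]
      exact Nat.pow_le_pow_left (by nlinarith) c
    have h3 : 1 ≤ n ^ (2 * c) := Nat.one_le_pow _ _ (by omega)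
    rw [Nat.add_sub_cancel, pow_succ]
    nlinarith
  have hsub : {i | s i ≤ ((m ^ c : ℕ) : ℕ∞)} ⊆
      insert x (f '' {j | t j ≤ (((m - 1) ^ (2 * c + 1) : ℕ) : ℕ∞)}) := by
    intro i (hi : s i ≤ _)
    rcases h i with rfl | htop | ⟨j, rfl, hj⟩
    · exact mem_insert _ _
    · rw [htop] at hi
      exact absurd (top_le_iff.1 hi) (ENat.natCast_ne_top _)
    · refine mem_insert_of_mem _ ⟨j, ?_, rfl⟩
      calc t j ≤ s (f j) + k := hj
        _ ≤ ((m ^ c : ℕ) : ℕ∞) + k := by gcongr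
        _ ≤ _ := by exact_mod_cast hle
  calc _ ≤ _ := encard_le_encard hsub
    _ ≤ (f '' {j | t j ≤ (((m - 1) ^ (2 * c + 1) : ℕ) : ℕ∞)}).encard + 1 := encard_insert_le _ _
    _ ≤ ((m - 1 : ℕ) : ℕ∞) + 1 := by
        gcongr
        exact (encard_image_le _ _).trans h1
    _ = m := by
        have : m - 1 + 1 = m := by omega
        exact_mod_cast this

theorem self_pow : SparseSizes fun i : ℕ => ((i ^ i : ℕ) : ℕ∞) := by
  intro c
  filter_upwards [eventually_ge_atTop (c + 2)] with m hm
  calc _ ≤ (Finset.range m : Set ℕ).encard := by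
        refine encard_le_encard fun i hi => ?_
        replace hi : ((i ^ i : ℕ) : ℕ∞) ≤ ((m ^ c : ℕ) : ℕ∞) := hi
        rw [Finset.coe_range, mem_Iio]
        by_contra! hmi
        have h1 : i ^ i ≤ m ^ c := by exact_mod_cast hi
        have h2 : m ^ c < m ^ m := Nat.pow_lt_pow_right (by omega) (by omega)
        have h3 : m ^ m ≤ i ^ m := Nat.pow_le_pow_left hmi m
        have h4 : i ^ m ≤ i ^ i := Nat.pow_le_pow_right (by omega) hmi
        omega
    _ = m := by rw [encard_coe_eq_coe_finsetCard, Finset.card_range]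

/-- Diagonalization of a decreasing sequence of sparse families. -/
theorem exists_diagonal {s : ℕ → ℕ → ℕ∞} (hs : ∀ j, SparseSizes (s j)) (hanti : Antitone s) :
    ∃ j : ℕ → ℕ, Tendsto j atTop atTop ∧ SparseSizes fun i => s (j i) i := by
  obtain ⟨n, hn, hN⟩ := extraction_forall_of_eventually
    (P := fun J n => ∀ m ≥ n, {i | s J i ≤ ((m ^ J : ℕ) : ℕ∞)}.encard ≤ m)
    fun J => eventually_forall_ge_atTop.2 (hs J J)
  -- Index `i` advances to level `j` only when its size there exceeds `n j ^ j`; a size at most `m ^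
  -- c` thus forces a level whose threshold is at most `m`.
  let j : ℕ → ℕ := fun i => Nat.findGreatest (fun j => ((n j ^ j : ℕ) : ℕ∞) < s j i) i
  refine ⟨j, tendsto_atTop.2 fun J => ?_, fun c => ?_⟩
  · have hfin : {i | s J i ≤ ((n J ^ J : ℕ) : ℕ∞)}.Finite :=
      finite_of_encard_le_coe (hN J _ le_rfl)
    have := hfin.compl_mem_cofinite
    rw [Nat.cofinite_eq_atTop] at this
    filter_upwards [this, eventually_ge_atTop J] with i hi hJ
    exact Nat.le_findGreatest hJ (not_le.1 hi)
  · filter_upwards [eventually_ge_atTop (n c), eventually_ge_atTop 1] with m hm hm1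
    let J := Nat.findGreatest (fun J => n J ≤ m) m
    have hcm : c ≤ m := (hn.id_le c).trans hm
    have hcJ : c ≤ J := Nat.le_findGreatest hcm hm
    have hJ : n J ≤ m := Nat.findGreatest_spec (P := fun J => n J ≤ m) hcm hm
    refine (encard_le_encard ?_).trans (hN J m hJ)
    intro i (hi : s (j i) i ≤ ((m ^ c : ℕ) : ℕ∞))
    have hjJ : j i ≤ J := by
      by_contra! hlt
      have h1 : m < n (j i) := by
        by_contra! hle
        exact absurd (Nat.le_findGreatest (P := fun J => n J ≤ m)
          ((hn.id_le (j i)).trans hle) hle) (not_le.2 hlt)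
      have h2 : ((n (j i) ^ (j i) : ℕ) : ℕ∞) < s (j i) i :=
        Nat.findGreatest_of_ne_zero (P := fun j => ((n j ^ j : ℕ) : ℕ∞) < s j i) rfl
          (show j i ≠ 0 by omega)
      have h3 : n (j i) ^ (j i) < m ^ c := by exact_mod_cast h2.trans_le hi
      have h4 : m ^ c ≤ n (j i) ^ c := Nat.pow_le_pow_left h1.le c
      have h5 : n (j i) ^ c ≤ n (j i) ^ (j i) := Nat.pow_le_pow_right (by omega) (by omega)
      omega
    calc s J i ≤ s (j i) i := hanti hjJ i
      _ ≤ _ := hi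
      _ ≤ _ := by exact_mod_cast Nat.pow_le_pow_right hm1 hcJ

/-- A sparse sequence of finite sets can be split: there are pairwise disjoint subsets in two
sparse families. The proof is an application of Hall's theorem. -/
theorem exists_split {G : ℕ → Finset ℕ} (hG : SparseSizes fun i => ((G i).card : ℕ∞)) :
    ∃ P Q : ℕ → Finset ℕ, (∀ i, P i ⊆ G i) ∧ (∀ i, Q i ⊆ G i) ∧ (∀ i k, Disjoint (P i) (Q k)) ∧
      (SparseSizes fun i => ((P i).card : ℕ∞)) ∧ SparseSizes fun i => ((Q i).card : ℕ∞) := by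
  obtain ⟨M, hM⟩ := eventually_atTop.1 (hG 2)
  -- Each of the two pieces asks for `r` points. If `m` is the largest size involved, at most `√m +
  -- 1` sets compete, each asking for at most `√m - 1` points in all, so Hall's condition holds.
  -- Below `M ^ 2` the count of sets is not controlled, so nothing is asked.
  let r : ℕ → ℕ := fun m => if m < M ^ 2 then 0 else (m.sqrt - 1) / 2
  have hr : Monotone r := by
    intro a b hab
    have : a.sqrt ≤ b.sqrt := Nat.sqrt_le_sqrt hab
    simp only [r]
    split_ifs <;> omega
  let J := Σ i : ℕ, Fin (r (G i).card) ⊕ Fin (r (G i).card)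
  have hall : ∀ S : Finset J, S.card ≤ (S.biUnion fun x => G x.1).card := by
    intro S
    rcases S.eq_empty_or_nonempty with rfl | hS
    · simp
    obtain ⟨x, hxS, hx⟩ := S.exists_max_image (fun x => (G x.1).card) hS
    set m := (G x.1).card with hm
    have hsub : G x.1 ⊆ S.biUnion fun x => G x.1 := fun a ha =>
      Finset.mem_biUnion.2 ⟨x, hxS, ha⟩
    refine le_trans ?_ (Finset.card_le_card hsub)
    have hmM : M ^ 2 ≤ m := by
      by_contra! hlt
      have h0 : r (G x.1).card = 0 := if_pos hlt
      rcases x with ⟨i, y | y⟩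
      · exact absurd y.2 (by simp only at h0; omega)
      · exact absurd y.2 (by simp only at h0; omega)
    have hMs : M ≤ m.sqrt := Nat.le_sqrt'.2 hmM
    have hF : {i | ((G i).card : ℕ∞) ≤ (((m.sqrt + 1) ^ 2 : ℕ) : ℕ∞)}.encard
        ≤ ((m.sqrt + 1 : ℕ) : ℕ∞) := hM _ (by omega)
    have hfin := finite_of_encard_le_coe hF
    have hFc : hfin.toFinset.card ≤ m.sqrt + 1 := by
      rw [hfin.encard_eq_coe_toFinset_card] at hF
      exact_mod_cast hF
    have hSsub : S ⊆ (hfin.toFinset.filter fun i => (G i).card ≤ m).sigma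
        fun _ => Finset.univ := by
      intro y hy
      have h1 : (G y.1).card ≤ m := hx y hy
      have h2 : m ≤ (m.sqrt + 1) ^ 2 := by
        have := Nat.lt_succ_sqrt' m
        exact this.le
      rw [Finset.mem_sigma, Finset.mem_filter, Finite.mem_toFinset]
      exact ⟨⟨by simpa only [mem_ofPred_eq, Nat.cast_le] using h1.trans h2, h1⟩, Finset.mem_univ _⟩
    calc S.card ≤ _ := Finset.card_le_card hSsub
      _ = ∑ i ∈ hfin.toFinset.filter fun i => (G i).card ≤ m, 2 * r (G i).card := by
          rw [Finset.card_sigma]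
          refine Finset.sum_congr rfl fun i _ => ?_
          rw [Finset.card_univ, Fintype.card_sum, Fintype.card_fin, two_mul]
      _ ≤ (hfin.toFinset.filter fun i => (G i).card ≤ m).card • (2 * r m) := by
          refine Finset.sum_le_card_nsmul _ _ _ fun i hi => ?_
          have := hr (Finset.mem_filter.1 hi).2
          omega
      _ ≤ (m.sqrt + 1) * (m.sqrt - 1) := by
          rw [smul_eq_mul]
          refine Nat.mul_le_mul ((Finset.card_filter_le _ _).trans hFc) ?_
          simp only [r, if_neg (not_lt.2 hmM)]
          omega
      _ ≤ m := by
          have h1 := Nat.sqrt_le' m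
          rcases Nat.eq_zero_or_pos m.sqrt with h | h
          · rw [h]; omega
          · obtain ⟨q, hq⟩ : ∃ q, m.sqrt = q + 1 := ⟨m.sqrt - 1, by omega⟩
            rw [hq] at h1 ⊢
            rw [Nat.add_sub_cancel]
            nlinarith
  obtain ⟨f, hf, hfG⟩ := (Finset.all_card_le_biUnion_card_iff_exists_injective
    (fun x : J => G x.1)).1 hall
  have hsparse : SparseSizes fun i => ((r (G i).card : ℕ) : ℕ∞) := by
    intro c
    filter_upwards [hG (2 * c + 2), eventually_ge_atTop (M ^ 2 + 5)] with m h1 hm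
    refine (encard_le_encard ?_).trans h1
    intro i (hi : ((r (G i).card : ℕ) : ℕ∞) ≤ _)
    have hi' : r (G i).card ≤ m ^ c := by exact_mod_cast hi
    show ((G i).card : ℕ∞) ≤ _
    rw [Nat.cast_le]
    by_cases hlt : (G i).card < M ^ 2
    · calc (G i).card ≤ m := by omega
        _ = m ^ 1 := (pow_one m).symm
        _ ≤ _ := Nat.pow_le_pow_right (by omega) (by omega)
    · simp only [r, if_neg hlt] at hi'
      have h2 : 1 ≤ m ^ c := Nat.one_le_pow _ _ (by omega)
      have h3 := (Nat.lt_succ_sqrt' (G i).card).le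
      calc (G i).card ≤ ((G i).card.sqrt + 1) ^ 2 := h3
        _ ≤ (m ^ c * m) ^ 2 := Nat.pow_le_pow_left (by
            have : (G i).card.sqrt + 1 ≤ 5 * m ^ c := by omega
            nlinarith) 2
        _ = m ^ (2 * c + 2) := by ring
  refine ⟨fun i => Finset.univ.image fun k => f ⟨i, Sum.inl k⟩,
    fun i => Finset.univ.image fun k => f ⟨i, Sum.inr k⟩, ?_, ?_, ?_, ?_, ?_⟩
  · intro i a ha
    obtain ⟨k, -, rfl⟩ := Finset.mem_image.1 ha
    exact hfG ⟨i, _⟩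
  · intro i a ha
    obtain ⟨k, -, rfl⟩ := Finset.mem_image.1 ha
    exact hfG ⟨i, _⟩
  · intro i k
    rw [Finset.disjoint_left]
    intro a ha hb
    obtain ⟨x, -, rfl⟩ := Finset.mem_image.1 ha
    obtain ⟨y, -, hy⟩ := Finset.mem_image.1 hb
    obtain ⟨rfl, h⟩ := Sigma.mk.inj_iff.1 (hf hy)
    simp at h
  · refine hsparse.mono fun i => ?_
    rw [Finset.card_image_of_injective _ fun x y h =>
      Sum.inl_injective (eq_of_heq (Sigma.mk.inj_iff.1 (hf h)).2)]
    simp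
  · refine hsparse.mono fun i => ?_
    rw [Finset.card_image_of_injective _ fun x y h =>
      Sum.inr_injective (eq_of_heq (Sigma.mk.inj_iff.1 (hf h)).2)]
    simp

end SparseSizes

/-! ### Disjoint pairs of sets with sparse traces -/

theorem exists_finset_subset_encard (s : Set ℕ) (k : ℕ) :
    ∃ G : Finset ℕ, (G : Set ℕ) ⊆ s ∧ min s.encard k ≤ (G.card : ℕ∞) := by
  obtain ⟨t, hts, ht⟩ := exists_subset_encard_eq (min_le_left s.encard (k : ℕ∞))
  have hfin : t.Finite := finite_of_encard_le_coe (ht.le.trans (min_le_right _ _))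
  refine ⟨hfin.toFinset, by simpa using hts, ?_⟩
  rw [← ht, hfin.encard_eq_coe_toFinset_card]

/-- Two disjoint sets almost disjoint from an increasing sequence `V` that both meet the sets of a
sequence `A` in sparse sizes, provided that `A` has sparse sizes outside each `V j`. -/
theorem exists_disjoint_pair {A V : ℕ → Set ℕ} (hV : Monotone V)
    (hA : ∀ j, SparseSizes fun i => (A i \ V j).encard) :
    ∃ P Q : Set ℕ, Disjoint P Q ∧ (∀ j, (P ∩ V j).Finite) ∧ (∀ j, (Q ∩ V j).Finite) ∧
      (SparseSizes fun i => (A i ∩ P).encard) ∧ SparseSizes fun i => (A i ∩ Q).encard := by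
  obtain ⟨j, hj, hs⟩ := SparseSizes.exists_diagonal hA
    fun a b hab i => encard_le_encard (sdiff_subset_sdiff_right (hV hab))
  -- Truncation at `i ^ i` makes the sets finite, as Hall's theorem needs, and keeps the sizes
  -- sparse.
  choose G hGsub hGcard using fun i => exists_finset_subset_encard (A i \ V (j i)) (i ^ i)
  obtain ⟨P, Q, hP, hQ, hPQ, hPs, hQs⟩ :=
    SparseSizes.exists_split ((hs.min SparseSizes.self_pow).mono hGcard)
  have hfin : ∀ R : ℕ → Finset ℕ, (∀ i, R i ⊆ G i) → ∀ k,
      ((⋃ i, (R i : Set ℕ)) ∩ V k).Finite := by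
    intro R hR k
    have hk := tendsto_atTop.1 hj k
    rw [← Nat.cofinite_eq_atTop] at hk
    refine (Finite.biUnion (eventually_cofinite.1 hk) fun i _ => (R i).finite_toSet).subset ?_
    rintro a ⟨ha, hak⟩
    obtain ⟨i, hi⟩ := mem_iUnion.1 ha
    refine mem_iUnion₂.2 ⟨i, fun hle => ?_, hi⟩
    exact (hGsub i (hR i hi)).2 (hV hle hak)
  have hcard : ∀ R : ℕ → Finset ℕ, (∀ i, R i ⊆ G i) → ∀ i,
      ((R i).card : ℕ∞) ≤ (A i ∩ ⋃ i, (R i : Set ℕ)).encard := by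
    intro R hR i
    rw [← encard_coe_eq_coe_finsetCard]
    exact encard_le_encard fun a ha => ⟨(hGsub i (hR i ha)).1, mem_iUnion.2 ⟨i, ha⟩⟩
  refine ⟨⋃ i, P i, ⋃ i, Q i, ?_, hfin P hP, hfin Q hQ, hPs.mono (hcard P hP),
    hQs.mono (hcard Q hQ)⟩
  simp only [disjoint_iUnion_left, disjoint_iUnion_right, Finset.disjoint_coe]
  exact fun i k => hPQ k i

theorem SparseSizes.infinite_of_inter {A : ℕ → Set ℕ} {P : Set ℕ}
    (h : SparseSizes fun i => (A i ∩ P).encard) : P.Infinite := by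
  intro hP
  refine infinite_univ (α := ℕ) ((h.finite_le P.ncard).subset fun i _ => ?_)
  show (A i ∩ P).encard ≤ _
  rw [hP.cast_ncard_eq]
  exact encard_le_encard inter_subset_right

/-- The relation between a pair `x` of disjoint infinite sets and a family `f` of such pairs which
allows `x` to be put on top of `f`: both members of `x` are almost contained in the second members
of `f`, and they meet the first members of `f` in sparse sizes. -/
structure ExtendsTower {κ : Type*} (f : κ → Set ℕ × Set ℕ) (x : Set ℕ × Set ℕ) : Prop where
  disjoint : Disjoint x.1 x.2
  infinite_fst : x.1.Infinite
  infinite_snd : x.2.Infinite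
  fst_almost_subset : ∀ b, (x.1 \ (f b).2).Finite
  snd_almost_subset : ∀ b, (x.2 \ (f b).2).Finite
  sparse_fst : SparseSizes fun b => ((f b).1 ∩ x.1).encard
  sparse_snd : SparseSizes fun b => ((f b).1 ∩ x.2).encard

theorem exists_not_countable_subset_Iio {ι : Type*} {S : Set ι} {g : ι → Set ℕ} (hS : ¬ S.Countable)
    (hg : ∀ s ∈ S, (g s).Finite) : ∃ n : ℕ, ¬ {s ∈ S | g s ⊆ Iio n}.Countable := by
  by_contra! h
  refine hS ((countable_iUnion h).mono fun s hs => ?_)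
  obtain ⟨n, hn⟩ := (hg s hs).bddAbove
  exact mem_iUnion.2 ⟨n + 1, hs, fun k hk => Nat.lt_succ_of_le (hn hk)⟩

/-! ### Construction of the tower -/

section Tower

variable {ι : Type*} [LinearOrder ι]

/-- A tower indexed by a linear order: each pair extends the family of all the previous ones. -/
def IsTower (f : ι → Set ℕ × Set ℕ) : Prop :=
  ∀ a, ExtendsTower (fun b : Iio a => f b) (f a)

/-- The part of a tower below `a`. -/
def IsTowerBelow (f : ι → Set ℕ × Set ℕ) (a : ι) : Prop :=
  ∀ c < a, ExtendsTower (fun b : Iio c => f b) (f c)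

/-- If `c` is the largest index in `F`, the complement of the union is `(f c).2` up to a finite set.
Before `c` the traces on it are sparse by `sparse_snd`, after `c` they are infinite, and `c` itself
is the one exception. The copies of `univ` make the index set infinite even at finite stages, which
later forces the new sets to be infinite. -/
theorem IsTowerBelow.sparseSizes_diff {f : ι → Set ℕ × Set ℕ} {a : ι} (hf : IsTowerBelow f a)
    {F : Set (Iio a)} (hF : F.Finite) :
    SparseSizes fun y : Iio a ⊕ ℕ =>
      (Sum.elim (fun b : Iio a => (f b).1) (fun _ => univ) y \ ⋃ b ∈ F, (f b).2ᶜ).encard := by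
  rcases F.eq_empty_or_nonempty with rfl | hne
  · have h0 : SparseSizes (fun _ : Empty => (0 : ℕ∞)) := by
      intro c
      filter_upwards with m
      simp [Set.eq_empty_of_isEmpty]
    refine h0.of_le_add Empty.elim (Sum.inr 0) 0 fun y => Or.inr (Or.inl ?_)
    simp only [mem_empty_iff_false, iUnion_of_empty, iUnion_empty, sdiff_empty]
    rcases y with b | n
    · exact (hf b b.2).infinite_fst.encard_eq
    · exact infinite_univ.encard_eq
  obtain ⟨c, hcF, hc⟩ := exists_max_image F id hF hne
  set V := ⋃ b ∈ F, (f b).2ᶜ with hV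
  have hfin : ((f c).2 ∩ V).Finite := by
    rw [hV, inter_iUnion₂]
    refine hF.biUnion fun b hb => ?_
    rw [← Set.sdiff_eq]
    rcases (hc b hb).lt_or_eq with hlt | heq
    · exact (hf c c.2).snd_almost_subset ⟨b, hlt⟩
    · rw [show b = c from heq, sdiff_self]
      exact finite_empty
  have htop : ∀ B : Set ℕ, (B ∩ (f c).2).Infinite → (B \ V).encard = ⊤ := by
    intro B hB
    refine Infinite.encard_eq ((hB.sdiff hfin).mono ?_)
    rintro n ⟨⟨hnB, hn⟩, hnV⟩
    exact ⟨hnB, fun h => hnV ⟨hn, h⟩⟩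
  refine (hf c c.2).sparse_snd.of_le_add (fun b => Sum.inl ⟨b, lt_trans b.2 c.2⟩) (Sum.inl c)
    ((f c).2 ∩ V).ncard fun y => ?_
  rcases y with b | n
  · rcases lt_trichotomy b c with hlt | rfl | hgt
    · refine Or.inr (Or.inr ⟨⟨b, hlt⟩, rfl, ?_⟩)
      rw [hfin.cast_ncard_eq]
      refine (encard_le_encard ?_).trans (encard_union_le _ _)
      rintro n ⟨hn, hnc⟩
      by_cases hnV : n ∈ V
      · exact Or.inr ⟨hnc, hnV⟩
      · exact Or.inl ⟨hn, hnV⟩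
    · exact Or.inl rfl
    · refine Or.inr (Or.inl (htop _ ?_))
      have h := (hf b b.2).infinite_fst.sdiff ((hf b b.2).fst_almost_subset ⟨c, hgt⟩)
      rwa [Set.sdiff_sdiff_right_self] at h
  · refine Or.inr (Or.inl (htop _ ?_))
    simpa using (hf c c.2).infinite_snd

theorem IsTowerBelow.exists_extendsTower {f : ι → Set ℕ × Set ℕ} {a : ι} [Countable (Iio a)]
    (hf : IsTowerBelow f a) : ∃ x, ExtendsTower (fun b : Iio a => f b) x := by
  obtain ⟨hden⟩ := nonempty_denumerable (Iio a ⊕ ℕ)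
  let e : Iio a ⊕ ℕ ≃ ℕ := Denumerable.eqv _
  let F : ℕ → Set (Iio a) := fun j => {b | e (Sum.inl b) ≤ j}
  have hF : ∀ j, (F j).Finite := fun j =>
    (finite_Iic j).preimage (e.injective.comp Sum.inl_injective).injOn
  obtain ⟨P, Q, hPQ, hP, hQ, hPs, hQs⟩ := exists_disjoint_pair
    (A := fun i => Sum.elim (fun b : Iio a => (f b).1) (fun _ => univ) (e.symm i))
    (V := fun j => ⋃ b ∈ F j, (f b).2ᶜ)
    (fun i j hij => biUnion_subset_biUnion_left fun b (hb : _ ≤ i) => hb.trans hij)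
    (fun j => (hf.sparseSizes_diff (hF j)).comp_injective e.symm.injective)
  have hsub : ∀ (R : Set ℕ) (b : Iio a),
      R \ (f b).2 ⊆ R ∩ ⋃ b' ∈ F (e (Sum.inl b)), (f b').2ᶜ := fun R b n hn =>
    ⟨hn.1, mem_iUnion₂.2 ⟨b, le_refl (e (Sum.inl b)), hn.2⟩⟩
  have hinj := e.injective.comp (Sum.inl_injective (α := Iio a) (β := ℕ))
  refine ⟨(P, Q), hPQ, hPs.infinite_of_inter, hQs.infinite_of_inter,
    fun b => (hP _).subset (hsub P b), fun b => (hQ _).subset (hsub Q b), ?_, ?_⟩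
  · refine (hPs.comp_injective hinj).mono fun b => ?_
    simp
  · refine (hQs.comp_injective hinj).mono fun b => ?_
    simp

theorem exists_tower [WellFoundedLT ι] [∀ a : ι, Countable (Iio a)] :
    ∃ f : ι → Set ℕ × Set ℕ, IsTower f := by
  let f : ι → Set ℕ × Set ℕ := (wellFounded_lt (α := ι)).fix fun a rec =>
    Classical.epsilon (ExtendsTower fun b : Iio a => rec b b.2)
  have hf : ∀ a, f a = Classical.epsilon (ExtendsTower fun b : Iio a => f b) := fun a =>
    WellFounded.fix_eq _ _ a
  refine ⟨f, fun a => ?_⟩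
  induction a using WellFoundedLT.induction with
  | ind a ih =>
    rw [hf a]
    exact Classical.epsilon_spec (IsTowerBelow.exists_extendsTower (f := f) ih)

/-! ### The almost disjoint family of first members -/

namespace IsTower

variable {f : ι → Set ℕ × Set ℕ}

theorem finite_inter_of_lt (hf : IsTower f) {a b : ι} (hab : a < b) :
    ((f a).1 ∩ (f b).1).Finite := by
  refine ((hf b).fst_almost_subset ⟨a, hab⟩).subset ?_
  rintro n ⟨hna, hnb⟩
  exact ⟨hnb, disjoint_left.1 (hf a).disjoint hna⟩

theorem finite_inter (hf : IsTower f) {a b : ι} (hab : a ≠ b) :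
    ((f a).1 ∩ (f b).1).Finite := by
  rcases hab.lt_or_gt with h | h
  · exact hf.finite_inter_of_lt h
  · rw [inter_comm]
    exact hf.finite_inter_of_lt h

theorem injective_fst (hf : IsTower f) : Function.Injective fun a => (f a).1 := by
  intro a b (hab : (f a).1 = (f b).1)
  by_contra hne
  have := hf.finite_inter hne
  rw [← hab, inter_self] at this
  exact (hf a).infinite_fst this

theorem isAlmostDisjoint_range [Infinite ι] (hf : IsTower f) :
    IsAlmostDisjoint (range fun a => (f a).1) := by
  refine ⟨infinite_range_of_injective hf.injective_fst, ?_, ?_⟩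
  · rintro _ ⟨a, rfl⟩
    exact (hf a).infinite_fst
  · rintro _ ⟨a, rfl⟩ _ ⟨b, rfl⟩ hab
    exact hf.finite_inter fun h => hab (by rw [h])

/-- In an order with countable initial segments, some element of an uncountable set lies above any
given countable set. -/
theorem _root_.Set.exists_mem_forall_lt_of_countable [∀ a : ι, Countable (Iio a)] {S T : Set ι}
    (hS : S.Countable) (hT : ¬ T.Countable) : ∃ c ∈ T, ∀ s ∈ S, s < c := by
  by_contra! h
  refine hT ((hS.biUnion (t := fun s _ => Iic s) fun s _ => ?_).mono fun c hc => ?_)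
  · rw [← Iio_insert]
    exact (countable_coe_iff.1 inferInstance).insert s
  · obtain ⟨s, hs, hcs⟩ := h c hc
    exact mem_iUnion₂.2 ⟨s, hs, hcs⟩

/-- Uniformize the finite errors of a separator `X` to `m` and `n` on uncountable subfamilies. Some
`c` from the second lies above infinitely many members of the first, and each of these meets `(f
c).1` in at most `m + n` points, against sparseness. -/
theorem not_areSeparated [∀ a : ι, Countable (Iio a)] (hf : IsTower f) {B C : Set (Set ℕ)}
    (hBf : B ⊆ range fun a => (f a).1) (hCf : C ⊆ range fun a => (f a).1) (hB : ¬ B.Countable)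
    (hC : ¬ C.Countable) : ¬ AreSeparated B C := by
  rintro ⟨X, hBX, hCX⟩
  have hpre : ∀ {D : Set (Set ℕ)}, D ⊆ (range fun a => (f a).1) → ¬ D.Countable →
      ¬ {a | (f a).1 ∈ D}.Countable := by
    intro D hDf hD hc
    refine hD ((hc.image fun a => (f a).1).mono fun d hd => ?_)
    obtain ⟨a, rfl⟩ := hDf hd
    exact ⟨a, hd, rfl⟩
  obtain ⟨m, hm⟩ := exists_not_countable_subset_Iio (hpre hBf hB)
    (g := fun a => (f a).1 \ X) fun a ha => hBX _ ha
  obtain ⟨n, hn⟩ := exists_not_countable_subset_Iio (hpre hCf hC)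
    (g := fun a => (f a).1 ∩ X) fun a ha => hCX _ ha
  have hinf : {a ∈ {a | (f a).1 ∈ B} | (f a).1 \ X ⊆ Iio m}.Infinite := fun h => hm h.countable
  let u := hinf.natEmbedding
  have hSinf : (range fun k => (u k : ι)).Infinite :=
    infinite_range_of_injective (Subtype.val_injective.comp u.injective)
  have hSsub : (range fun k => (u k : ι)) ⊆ {a ∈ {a | (f a).1 ∈ B} | (f a).1 \ X ⊆ Iio m} := by
    rintro _ ⟨k, rfl⟩
    exact (u k).2
  obtain ⟨c, hc, hSc⟩ := exists_mem_forall_lt_of_countable (countable_range fun k => (u k : ι)) hn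
  refine hSinf ((((hf c).sparse_fst.finite_le (m + n)).image Subtype.val).subset fun s hs => ?_)
  refine ⟨⟨s, hSc s hs⟩, ?_, rfl⟩
  calc ((f s).1 ∩ (f c).1).encard ≤ (Iio m ∪ Iio n).encard := by
        refine encard_le_encard fun k hk => ?_
        by_cases hkX : k ∈ X
        · exact Or.inr (hc.2 ⟨hk.2, hkX⟩)
        · exact Or.inl ((hSsub hs).2 ⟨hk.1, hkX⟩)
    _ ≤ (Iio m).encard + (Iio n).encard := encard_union_le _ _
    _ = ((m + n : ℕ) : ℕ∞) := by
        rw [← Finset.coe_Iio, ← Finset.coe_Iio, encard_coe_eq_coe_finsetCard,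
          encard_coe_eq_coe_finsetCard, Nat.card_Iio, Nat.card_Iio, Nat.cast_add]

theorem areSeparated_of_countable [Uncountable ι] [∀ a : ι, Countable (Iio a)] (hf : IsTower f)
    {B : Set (Set ℕ)} (hBf : B ⊆ range fun a => (f a).1) (hB : B.Countable) :
    AreSeparated B ((range fun a => (f a).1) \ B) := by
  obtain ⟨c, -, hc⟩ := exists_mem_forall_lt_of_countable
    (hB.preimage hf.injective_fst) not_countable_univ
  obtain ⟨enc, henc⟩ := exists_injective_nat (Iio c)
  have henc_fin : ∀ n, {d | enc d ≤ n}.Finite := fun n =>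
    (finite_Iic n).preimage henc.injOn
  -- Removing only the members enumerated up to `b` outside `B` costs finitely many points, and a
  -- given member outside `B` then meets only the finitely many `Y b` enumerated before it.
  let Y : Iio c → Set ℕ := fun b =>
    (f b).1 \ ⋃ d ∈ {d : Iio c | enc d ≤ enc b ∧ (f d).1 ∉ B}, (f d).1
  refine ⟨(⋃ b ∈ {b : Iio c | (f b).1 ∈ B}, Y b) \ ((f c).1 ∪ (f c).2), ?_, ?_⟩
  · intro s hs
    obtain ⟨b, rfl⟩ := hBf hs
    have hbc : b < c := hc b hs
    have h1 : (⋃ d ∈ {d : Iio c | enc d ≤ enc ⟨b, hbc⟩ ∧ (f d).1 ∉ B},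
        (f b).1 ∩ (f d).1).Finite := by
      refine ((henc_fin _).subset fun d hd => hd.1).biUnion fun d hd => hf.finite_inter ?_
      rintro rfl
      exact hd.2 hs
    refine (h1.union (((hf c).fst_almost_subset ⟨b, hbc⟩).union
      ((hf c).snd_almost_subset ⟨b, hbc⟩))).subset ?_
    rintro n ⟨hnb, hn⟩
    have hnb2 : n ∉ (f b).2 := disjoint_left.1 (hf b).disjoint hnb
    by_contra! hcon
    rw [mem_union, mem_union, not_or, not_or] at hcon
    refine hn ⟨mem_iUnion₂.2 ⟨⟨b, hbc⟩, hs, hnb, fun h => ?_⟩, ?_⟩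
    · obtain ⟨d, hd, hnd⟩ := mem_iUnion₂.1 h
      exact hcon.1 (mem_iUnion₂.2 ⟨d, hd, hnb, hnd⟩)
    · rintro (h | h)
      · exact hcon.2.1 ⟨h, hnb2⟩
      · exact hcon.2.2 ⟨h, hnb2⟩
  · rintro _ ⟨⟨a, rfl⟩, ha⟩
    rcases lt_or_ge a c with hac | hac
    · have h1 : (⋃ d ∈ {d : Iio c | enc d ≤ enc ⟨a, hac⟩ ∧ (f d).1 ∈ B},
          (f a).1 ∩ (f d).1).Finite := by
        refine ((henc_fin _).subset fun d hd => hd.1).biUnion fun d hd => hf.finite_inter ?_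
        rintro rfl
        exact ha hd.2
      refine h1.subset ?_
      rintro n ⟨hna, hn, -⟩
      obtain ⟨b, hb, hnb, hn'⟩ := mem_iUnion₂.1 hn
      refine mem_iUnion₂.2 ⟨b, ⟨?_, hb⟩, hna, hnb⟩
      by_contra! hlt
      exact hn' (mem_iUnion₂.2 ⟨⟨a, hac⟩, ⟨hlt.le, ha⟩, hna⟩)
    · rcases hac.eq_or_lt with rfl | hlt
      · refine finite_empty.subset ?_
        rintro n ⟨hna, -, hn⟩
        exact hn (Or.inl hna)
      · refine ((hf a).fst_almost_subset ⟨c, hlt⟩).subset ?_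
        rintro n ⟨hna, -, hn⟩
        exact ⟨hna, fun h => hn (Or.inr h)⟩

end IsTower

end Tower

end ADFamily

theorem mainTheorem8 :
    ∃ A : Set (Set ℕ), ADFamily.IsInseparable A ∧
      ∀ B : Set (Set ℕ), B ⊆ A → B.Countable → ADFamily.AreSeparated B (A \ B) := by
  let ι := (Cardinal.aleph 1).ord.ToType
  have hι : Cardinal.mk ι = Cardinal.aleph 1 := Cardinal.mk_ord_toType _
  have hunc : Uncountable ι := by
    rw [← Cardinal.aleph0_lt_mk_iff, hι, ← Cardinal.aleph_zero]
    exact Cardinal.aleph_lt_aleph.2 one_pos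
  have hcount : ∀ a : ι, Countable (Set.Iio a) := fun a => by
    have h : Cardinal.mk (Set.Iio a) < Cardinal.aleph 1 :=
      (Cardinal.mk_Iio_lt a (by simp [ι])).trans_eq hι
    rw [← Cardinal.mk_le_aleph0_iff]
    rwa [← Order.lt_succ_iff, Cardinal.succ_aleph0]
  obtain ⟨f, hf⟩ := ADFamily.exists_tower (ι := ι)
  refine ⟨Set.range fun a => (f a).1, ⟨hf.isAlmostDisjoint_range, ?_, ?_⟩, ?_⟩
  · rw [Cardinal.mk_range_eq _ hf.injective_fst, hι]
  · exact fun B C => hf.not_areSeparated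
  · exact fun B => hf.areSeparated_of_countable
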